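/- Consider an instance of the related machine scheduling problem $Q||\sum C_j$: a finite set $J$ of jobs with processing times $p_j \ge 0$ and a set of $m \ge 1$ machines with arbitrary speeds $s_i > 0$; processing job $j$ on machine $i$ takes time $p_j/s_i$. Every machine processes the jobs assigned to it without idle time in the order of one common total order (priority list) on $J$ that follows the Shortest Processing Time (SPT) rule, i.e. in which $p_j \le p_k$ whenever $j$ precedes $k$. In the associated game each job $j$ chooses a machine $\tau_j$; in a profile $\tau = (\tau_j)_{j\in J}$ its cost is its completion time $C_j(\tau) = \sum_{k \le j,\ \tau_k = \tau_j} p_k/s_{\tau_j}$, and the social cost is $SC(\tau) = \sum_{j\in J} C_j(\tau)$. A profile is a pure Nash equilibrium if no job can decrease its completion time by changing its machine unilaterally, and the pure price of anarchy is $\sup_\tau SC(\tau)/\min_{\tau^*} SC(\tau^*)$, where $\tau$ ranges over all pure Nash equilibria and $\tau^*$ over all profiles (with $0/0 := 0$ and $a/0 := \infty$ for $a > 0$). Theorem 4. For every such instance the pure price of anarchy is at most $$2 - \frac{1}{2\,(2m-1)}.$$ The same number is an upper bound on the approximation ratio of the Ibarra–Kim greedy algorithm, which lists the jobs in a non-decreasing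 order of processing times and places them one after the other, each directly after the jobs already scheduled on a machine where its completion time is minimal: however ties are broken, the sum of completion times of the schedule it produces is at most $2 - \frac{1}{2(2m-1)}$ times the sum of completion times of any schedule of the jobs on the machines. -/

import Mathlib

namespace RelatedMachines

variable {J M : Type*}

/-! ### The scheduling game

Jobs are the elements of a finite linearly ordered type `J`; `j < k` means that `j` has higher
priority than `k` on every machine.  The priority order is an SPT order when the processing times
`p : J → ℝ` are monotone; ties in `p` are then resolved by the order of `J`, in the same way on all
machines.  Machine `i : M` has speed `s i`, and job `j` needs `p j / s i` time units on it.
A strategy profile is a map `τ : J → M`. -/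

section Game

variable [Fintype J] [LinearOrder J] [DecidableEq M]

/-- The completion time of job `j` in the profile `τ`: the jobs of priority at least that of `j`
which chose the same machine as `j` are processed up to that moment. -/
noncomputable def completionTime (s : M → ℝ) (p : J → ℝ) (τ : J → M) (j : J) : ℝ :=
  ∑ k : J with k ≤ j ∧ τ k = τ j, p k / s (τ j)

/-- The social cost: the sum of the completion times of all jobs. -/
noncomputable def socialCost (s : M → ℝ) (p : J → ℝ) (τ : J → M) : ℝ :=
  ∑ j : J, completionTime s p τ j

/-- Pure Nash equilibrium: no job can lower its completion time by moving, alone, to another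
machine. -/
def IsNashEquilibrium (s : M → ℝ) (p : J → ℝ) (τ : J → M) : Prop :=
  ∀ (j : J) (i : M), completionTime s p τ j ≤ completionTime s p (Function.update τ j i) j

/-- The minimal social cost of a strategy profile. -/
noncomputable def optimalCost (s : M → ℝ) (p : J → ℝ) : ℝ :=
  ⨅ τ : J → M, socialCost s p τ

/-- The pure price of anarchy of an instance: the supremum, over all pure Nash equilibria, of the
ratio of the social cost to the optimal one.  It takes values in `[0, ∞]`, where a positive number
divided by `0` is `∞`, and `0 / 0 = 0`. -/
noncomputable def priceOfAnarchy (s : M → ℝ) (p : J → ℝ) : ENNReal :=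
  ⨆ (τ : J → M) (_ : IsNashEquilibrium s p τ),
    ENNReal.ofReal (socialCost s p τ) / ENNReal.ofReal (optimalCost s p)

end Game

/-! ### Schedules as lists of jobs, and the Ibarra–Kim algorithm

A (possibly partial) schedule assigns to every machine the list of its jobs, in the order in which
they are processed, starting at time `0` and without idle time. -/

/-- `S` is a complete schedule: each job appears exactly once, on exactly one machine. -/
def IsSchedule (S : M → List J) : Prop :=
  (∀ i, (S i).Nodup) ∧ ∀ j, ∃! i, j ∈ S i

/-- The sum of the completion times in the schedule `S`: the job in position `r` of the list of
machine `i` completes when the first `r + 1` jobs of this list have been processed. -/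
noncomputable def totalCompletionTime [Fintype M] (s : M → ℝ) (p : J → ℝ) (S : M → List J) : ℝ :=
  ∑ i : M, ∑ r ∈ Finset.range (S i).length, (((S i).take (r + 1)).map p).sum / s i

/-- The completion time of job `k` if it is put on machine `i` directly after the jobs of `S i`. -/
noncomputable def finishTime (s : M → ℝ) (p : J → ℝ) (S : M → List J) (k : J) (i : M) : ℝ :=
  (((S i).map p).sum + p k) / s i

/-- `GreedyRun s p l S T`: from the partial schedule `S`, processing the jobs of the list `l` one
after the other, and putting each directly after the jobs already scheduled on some machine on
which its completion time is minimal, can end in the schedule `T`.  All ways of breaking ties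
between machines are allowed. -/
inductive GreedyRun [DecidableEq M] (s : M → ℝ) (p : J → ℝ) :
    List J → (M → List J) → (M → List J) → Prop
  | nil (S : M → List J) : GreedyRun s p [] S S
  | cons (k : J) (l : List J) (S T : M → List J) (i : M)
      (hi : ∀ i' : M, finishTime s p S k i ≤ finishTime s p S k i')
      (hrun : GreedyRun s p l (Function.update S i (S i ++ [k])) T) :
      GreedyRun s p (k :: l) S T

/-- `T` is a possible output of the Ibarra–Kim algorithm: all jobs are listed in some
non-decreasing order of processing times, and are scheduled greedily along this list, starting from
the empty schedule. -/
def IsIbarraKimOutput [DecidableEq M] (s : M → ℝ) (p : J → ℝ) (T : M → List J) : Prop :=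
  ∃ l : List J, l.Nodup ∧ (∀ j, j ∈ l) ∧ l.Pairwise (fun j k => p j ≤ p k) ∧
    GreedyRun s p l (fun _ => []) T

end RelatedMachines

open scoped Finset

namespace RelatedMachines

variable {J M : Type*}

/-! Charge each job to the jobs it delays: the social cost becomes `∑ p k * (n k + 1) / s (σ k)`,
with `n k` the number of later jobs on its machine. Choosing machines from the last job to the first
so as to minimize this weight is optimal (`IsBackwardGreedy.socialCost_le`): summation by parts
reduces to suffixes, where machine `i` with `a` jobs contributes `a (a + 1) / 2 / s i`, and greedy
counts minimize this convex sum.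

Let `τ` be an equilibrium and compare each job with a move to its machine in the greedy optimum `σ`.
Summing and exchanging sums gives `SC(τ) ≤ 2 * SC(σ) - ∑ g k`, with slack `g k ≥ p k * n k / s (σ
k)`. It remains to bound `SC(σ)` by `2 m ∑ g k`: jobs with `n k ≥ 1` pay for themselves up to a
factor 2, and each of the at most `m` jobs that are last on their machine is charged to the jobs
sharing a machine with the overall last job. An Ibarra–Kim run satisfies the same inequalities as
`τ`. -/

theorem sum_laterCount_eq [LinearOrder J] [DecidableEq M] [Fintype M] (s : M → ℝ) (σ : J → M)
    (t : Finset J) :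
    ∑ j ∈ t, ((#{x ∈ t | j < x ∧ σ x = σ j} : ℝ) + 1) / s (σ j) =
      ∑ i, (#{j ∈ t | σ j = i} : ℝ) * (#{j ∈ t | σ j = i} + 1) / 2 / s i := by
  induction t using Finset.induction_on_min with
  | empty => simp
  | insert a t ha ih =>
    have hat : a ∉ t := fun h => (ha a h).false
    have h1 : ∑ j ∈ t, ((#{x ∈ insert a t | j < x ∧ σ x = σ j} : ℝ) + 1) / s (σ j) =
        ∑ j ∈ t, ((#{x ∈ t | j < x ∧ σ x = σ j} : ℝ) + 1) / s (σ j) := by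
      refine Finset.sum_congr rfl fun j hj => ?_
      rw [Finset.filter_insert, if_neg fun h => (ha j hj).not_gt h.1]
    have h2 : ({x ∈ insert a t | a < x ∧ σ x = σ a} : Finset J) = {x ∈ t | σ x = σ a} := by
      rw [Finset.filter_insert, if_neg fun h => h.1.false]
      exact Finset.filter_congr fun j hj => by simp [ha j hj]
    rw [Finset.sum_insert hat, h1, h2, ih, ← Finset.add_sum_erase _ _ (Finset.mem_univ (σ a)),
      ← Finset.add_sum_erase (a := σ a) Finset.univ
        (fun i => (#{j ∈ insert a t | σ j = i} : ℝ) * (#{j ∈ insert a t | σ j = i} + 1) / 2 / s i)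
        (Finset.mem_univ (σ a))]
    have h3 : ∑ i ∈ Finset.univ.erase (σ a),
        (#{j ∈ insert a t | σ j = i} : ℝ) * (#{j ∈ insert a t | σ j = i} + 1) / 2 / s i =
        ∑ i ∈ Finset.univ.erase (σ a),
          (#{j ∈ t | σ j = i} : ℝ) * (#{j ∈ t | σ j = i} + 1) / 2 / s i := by
      refine Finset.sum_congr rfl fun i hi => ?_
      rw [Finset.filter_insert, if_neg (Finset.ne_of_mem_erase hi).symm]
    rw [h3, Finset.filter_insert, if_pos rfl, Finset.card_insert_of_notMem (by simp [hat])]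
    push_cast
    ring

/-! ### Backward greedy profiles and their optimality. -/

section Game

variable [Fintype J] [LinearOrder J] [DecidableEq M]

/-- The number of jobs of lower priority than `k` that the profile `σ` puts on machine `i`. -/
def laterCount (σ : J → M) (k : J) (i : M) : ℕ :=
  #{j : J | k < j ∧ σ j = i}

/-- Every job is on a machine minimizing the weight (number of jobs not before it, over speed),
given the choices of the jobs of lower priority. -/
def IsBackwardGreedy (s : M → ℝ) (σ : J → M) : Prop :=
  ∀ k i, ((laterCount σ k (σ k) : ℝ) + 1) / s (σ k) ≤ ((laterCount σ k i : ℝ) + 1) / s i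

theorem laterCount_anti (σ : J → M) (i : M) {j k : J} (h : j ≤ k) :
    laterCount σ k i ≤ laterCount σ j i := by
  refine Finset.card_le_card fun x => ?_
  simp only [Finset.mem_filter, Finset.mem_univ, true_and]
  exact fun hx => ⟨h.trans_lt hx.1, hx.2⟩

theorem socialCost_eq_sum_laterCount (s : M → ℝ) (p : J → ℝ) (σ : J → M) :
    socialCost s p σ = ∑ k, p k * (((laterCount σ k (σ k) : ℝ) + 1) / s (σ k)) := by
  unfold socialCost completionTime
  simp_rw [Finset.sum_filter]
  rw [Finset.sum_comm]
  refine Finset.sum_congr rfl fun k _ => ?_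
  have h : ∀ j, (if k ≤ j ∧ σ k = σ j then p k / s (σ j) else 0) =
      (if k < j ∧ σ j = σ k then p k / s (σ k) else 0) + if j = k then p k / s (σ k) else 0 := by
    intro j
    rcases lt_trichotomy k j with h | rfl | h
    · by_cases h' : σ k = σ j
      · simp [h.le, h.ne', h, h']
      · simp [h.ne', h', Ne.symm h']
    · simp
    · simp [h.not_ge, h.not_gt, h.ne]
  simp_rw [h]
  rw [Finset.sum_add_distrib, ← Finset.sum_filter, Finset.sum_const, Finset.sum_ite_eq', laterCount]
  simp only [Finset.mem_univ, if_true, nsmul_eq_mul]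
  ring

theorem exists_isBackwardGreedy [Finite M] [Nonempty M] (s : M → ℝ) :
    ∃ σ : J → M, IsBackwardGreedy s σ := by
  suffices h : ∀ t : Finset J, ∃ σ : J → M, ∀ k ∈ t, ∀ i,
      ((#{j ∈ t | k < j ∧ σ j = σ k} : ℝ) + 1) / s (σ k) ≤
        ((#{j ∈ t | k < j ∧ σ j = i} : ℝ) + 1) / s i by
    obtain ⟨σ, hσ⟩ := h Finset.univ
    exact ⟨σ, fun k i => hσ k (Finset.mem_univ k) i⟩
  intro t
  induction t using Finset.induction_on_min with
  | empty => exact ⟨fun _ => Classical.arbitrary M, by simp⟩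
  | insert a t ha ih =>
    obtain ⟨σ, hσ⟩ := ih
    obtain ⟨i₀, hi₀⟩ := Finite.exists_min fun i => ((#{j ∈ t | σ j = i} : ℝ) + 1) / s i
    -- The new job precedes all of `t`, so placing it changes no count of later jobs.
    refine ⟨Function.update σ a i₀, ?_⟩
    have hne : ∀ j ∈ t, Function.update σ a i₀ j = σ j := fun j hj =>
      Function.update_of_ne (ha j hj).ne' _ _
    have hfil : ∀ k, a ≤ k → ∀ i, {j ∈ insert a t | k < j ∧ Function.update σ a i₀ j = i} =
        {j ∈ t | k < j ∧ σ j = i} := by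
      intro k hk i
      rw [Finset.filter_insert, if_neg fun h => hk.not_gt h.1]
      exact Finset.filter_congr fun j hj => by rw [hne j hj]
    intro k hk i
    rcases Finset.mem_insert.1 hk with rfl | hk
    · rw [hfil k le_rfl, hfil k le_rfl, Function.update_self]
      have h : ∀ i, {j ∈ t | k < j ∧ σ j = i} = {j ∈ t | σ j = i} := fun i =>
        Finset.filter_congr fun j hj => by simp [ha j hj]
      rw [h, h]
      exact hi₀ i
    · rw [hfil k (ha k hk).le, hfil k (ha k hk).le, hne k hk]
      exact hσ k hk i

/-- The first job after `k` on machine `i` has exactly the left side as its weight. It preferred `i`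
to `σ k` when `σ k` held no more jobs than `k` found there. -/
theorem IsBackwardGreedy.laterCount_div_le {s : M → ℝ} (hs : ∀ i, 0 < s i) {σ : J → M}
    (hσ : IsBackwardGreedy s σ) (k : J) (i : M) :
    (laterCount σ k i : ℝ) / s i ≤ ((laterCount σ k (σ k) : ℝ) + 1) / s (σ k) := by
  rcases ({j : J | k < j ∧ σ j = i} : Finset J).eq_empty_or_nonempty with h | h
  · have : laterCount σ k i = 0 := by rw [laterCount, h, Finset.card_empty]
    rw [this, Nat.cast_zero, zero_div]
    exact div_nonneg (by positivity) (hs _).le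
  · obtain ⟨j, hj, hmin⟩ := Finset.exists_minimal h
    simp only [Finset.mem_filter, Finset.mem_univ, true_and] at hj hmin
    have hset : ({x : J | k < x ∧ σ x = i} : Finset J) =
        insert j ({x : J | j < x ∧ σ x = i} : Finset J) := by
      ext x
      simp only [Finset.mem_filter, Finset.mem_univ, true_and, Finset.mem_insert]
      constructor
      · intro hx
        rcases lt_trichotomy x j with hxj | rfl | hxj
        · exact absurd (hmin hx hxj.le) hxj.not_ge
        · exact Or.inl rfl
        · exact Or.inr ⟨hxj, hx.2⟩
      · rintro (rfl | hx)
        · exact hj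
        · exact ⟨hj.1.trans hx.1, hx.2⟩
    have hc : laterCount σ k i = laterCount σ j i + 1 := by
      rw [laterCount, hset, Finset.card_insert_of_notMem (by simp), laterCount]
    have h1 := hσ j (σ k)
    rw [hj.2] at h1
    rw [hc, Nat.cast_succ]
    refine h1.trans (div_le_div_of_nonneg_right ?_ (hs _).le)
    have := laterCount_anti σ (σ k) hj.1.le
    gcongr

/-- Summation by parts for a monotone function. -/
theorem sum_mul_nonneg_of_suffix_sum_nonneg {p d : J → ℝ} (hp : ∀ j, 0 ≤ p j) (hmono : Monotone p)
    (hd : ∀ k, 0 ≤ ∑ j with k ≤ j, d j) : 0 ≤ ∑ j, p j * d j := by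
  -- The lower bound `c` makes the induction work: removing the least index `a` raises it to `p a`,
  -- at no loss because the full sum of `d` is nonnegative.
  suffices h : ∀ t : Finset J, (∀ k ∈ t, 0 ≤ ∑ j ∈ t with k ≤ j, d j) →
      ∀ c, (∀ j ∈ t, c ≤ p j) → c * ∑ j ∈ t, d j ≤ ∑ j ∈ t, p j * d j by
    simpa using h Finset.univ (fun k _ => hd k) 0 fun j _ => hp j
  intro t
  induction t using Finset.induction_on_min with
  | empty => simp
  | insert a t ha ih =>
    intro hd c hc
    have hat : a ∉ t := fun h => (ha a h).false
    have h1 := ih (fun k hk => by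
      have := hd k (Finset.mem_insert_of_mem hk)
      rwa [Finset.filter_insert, if_neg (ha k hk).not_ge] at this) (p a)
      fun j hj => hmono (ha j hj).le
    have h2 := hd a (Finset.mem_insert_self a t)
    rw [Finset.filter_true_of_mem (by
      intro j hj
      rcases Finset.mem_insert.1 hj with rfl | hj
      exacts [le_rfl, (ha j hj).le])] at h2
    have h3 := mul_le_mul_of_nonneg_right (hc a (Finset.mem_insert_self a t)) h2
    rw [Finset.sum_insert hat] at h3 ⊢
    rw [Finset.sum_insert hat]
    linarith

theorem IsBackwardGreedy.socialCost_le [Fintype M] {s : M → ℝ} (hs : ∀ i, 0 < s i) {p : J → ℝ}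
    (hp : ∀ j, 0 ≤ p j) (hSPT : Monotone p) {σ : J → M} (hσ : IsBackwardGreedy s σ) (ρ : J → M) :
    socialCost s p σ ≤ socialCost s p ρ := by
  rw [socialCost_eq_sum_laterCount, socialCost_eq_sum_laterCount, ← sub_nonneg,
    ← Finset.sum_sub_distrib]
  simp_rw [← mul_sub]
  refine sum_mul_nonneg_of_suffix_sum_nonneg hp hSPT fun k => ?_
  have hsum : ∀ π : J → M, ∑ j with k ≤ j, ((laterCount π j (π j) : ℝ) + 1) / s (π j) =
      ∑ i, (#{j : J | k ≤ j ∧ π j = i} : ℝ) * (#{j : J | k ≤ j ∧ π j = i} + 1) / 2 / s i := by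
    intro π
    have h := sum_laterCount_eq s π ({j : J | k ≤ j} : Finset J)
    simp_rw [Finset.filter_filter] at h
    rw [← h]
    refine Finset.sum_congr rfl fun j hj => ?_
    rw [laterCount]
    congr 4
    refine Finset.filter_congr fun x _ => ?_
    have hkj : k ≤ j := by simpa using hj
    exact ⟨fun hx => ⟨hkj.trans hx.1.le, hx⟩, fun hx => hx.2⟩
  have hcard : ∀ π : J → M, ∑ i, (#{j : J | k ≤ j ∧ π j = i} : ℝ) = #{j : J | k ≤ j} := by
    intro π
    rw [Finset.card_eq_sum_card_fiberwise (f := π) (t := Finset.univ) (by simp), Nat.cast_sum]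
    simp_rw [Finset.filter_filter]
  rw [Finset.sum_sub_distrib, hsum, hsum, ← Finset.sum_sub_distrib]
  -- `w` is a common marginal price: `a / s i ≤ w ≤ (a + 1) / s i` on every machine, so it serves as
  -- a subgradient. The linear terms cancel since both profiles place equally many jobs.
  set w := ((laterCount σ k (σ k) : ℝ) + 1) / s (σ k)
  have hw : ∑ i, w * ((#{j : J | k ≤ j ∧ ρ j = i} : ℝ) - #{j : J | k ≤ j ∧ σ j = i}) = 0 := by
    rw [← Finset.mul_sum, Finset.sum_sub_distrib, hcard, hcard, sub_self, mul_zero]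
  rw [← hw]
  refine Finset.sum_le_sum fun i _ => ?_
  have hcount : #{j : J | k ≤ j ∧ σ j = i} = laterCount σ k i + if σ k = i then 1 else 0 := by
    split_ifs with h
    · have : ({j : J | k ≤ j ∧ σ j = i} : Finset J) =
          insert k ({j : J | k < j ∧ σ j = i} : Finset J) := by
        ext x
        simp only [Finset.mem_filter, Finset.mem_univ, true_and, Finset.mem_insert, le_iff_eq_or_lt]
        constructor
        · rintro ⟨rfl | hx, hx'⟩
          exacts [Or.inl rfl, Or.inr ⟨hx, hx'⟩]
        · rintro (rfl | hx)
          exacts [⟨Or.inl rfl, h⟩, ⟨Or.inr hx.1, hx.2⟩]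
      rw [this, Finset.card_insert_of_notMem (by simp), laterCount]
    · rw [laterCount, add_zero]
      congr 1
      refine Finset.filter_congr fun x _ => ⟨fun hx => ⟨lt_of_le_of_ne hx.1 ?_, hx.2⟩,
        fun hx => ⟨hx.1.le, hx.2⟩⟩
      rintro rfl
      exact h hx.2
  have hupper : (#{j : J | k ≤ j ∧ σ j = i} : ℝ) / s i ≤ w := by
    rw [hcount]
    split_ifs with h
    · subst h
      push_cast
      exact le_rfl
    · simpa using hσ.laterCount_div_le hs k i
  have hlower : w ≤ ((#{j : J | k ≤ j ∧ σ j = i} : ℝ) + 1) / s i := by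
    refine (hσ k i).trans (div_le_div_of_nonneg_right ?_ (hs i).le)
    rw [hcount]
    push_cast
    gcongr
    simp only [le_add_iff_nonneg_right]
    positivity
  rw [div_le_iff₀ (hs i)] at hupper
  rw [le_div_iff₀ (hs i)] at hlower
  generalize #{j : J | k ≤ j ∧ σ j = i} = a at *
  generalize #{j : J | k ≤ j ∧ ρ j = i} = b at *
  rw [← sub_div, le_div_iff₀ (hs i)]
  -- Integrality matters: distinct counts differ by at least 1, which places `(a + b + 1) / 2` on
  -- the correct side of `a` or `a + 1`.
  rcases le_or_gt b a with h | h
  · have hab : (b : ℝ) ≤ a := by exact_mod_cast h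
    rcases h.eq_or_lt with rfl | h
    · simp
    · have hab' : (b : ℝ) + 1 ≤ a := by exact_mod_cast h
      nlinarith [mul_le_mul_of_nonneg_left hupper (sub_nonneg.2 hab)]
  · have hab : (a : ℝ) + 1 ≤ b := by exact_mod_cast h
    have hab' : (0 : ℝ) ≤ b - a := by linarith
    nlinarith [mul_le_mul_of_nonneg_left hlower hab']

/-! ### Comparison of an equilibrium with the greedy optimum. -/

theorem sum_sum_lt_div_eq (s : M → ℝ) (p : J → ℝ) (σ τ : J → M) :
    ∑ j, (∑ k with k < j ∧ τ k = σ j, p k) / s (σ j) =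
      ∑ k, p k * ((laterCount σ k (τ k) : ℝ) / s (τ k)) := by
  simp_rw [Finset.sum_div, Finset.sum_filter]
  rw [Finset.sum_comm]
  refine Finset.sum_congr rfl fun k _ => ?_
  have h : ∀ j, (if k < j ∧ τ k = σ j then p k / s (σ j) else 0) =
      if k < j ∧ σ j = τ k then p k / s (τ k) else 0 := by
    intro j
    by_cases h' : τ k = σ j
    · simp [h']
    · simp [h', Ne.symm h']
  simp_rw [h]
  rw [← Finset.sum_filter, Finset.sum_const, laterCount, nsmul_eq_mul]
  ring

/-- If no job would profit from being inserted on another machine according to its priority, then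
the social cost is at most `2 - 1 / (2 (2 m - 1))` times that of any profile. -/
theorem socialCost_le_mul_socialCost [Fintype M] [Nonempty M] {s : M → ℝ} (hs : ∀ i, 0 < s i)
    {p : J → ℝ} (hp : ∀ j, 0 ≤ p j) (hSPT : Monotone p) {τ : J → M}
    (hτ : ∀ j i, completionTime s p τ j ≤ (∑ k with k < j ∧ τ k = i, p k + p j) / s i)
    (ρ : J → M) :
    socialCost s p τ ≤ (2 - 1 / (2 * (2 * (Fintype.card M : ℝ) - 1))) * socialCost s p ρ := by
  have hm : (1 : ℝ) ≤ Fintype.card M := by exact_mod_cast Fintype.card_pos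
  have hδ : 1 / (2 * (2 * (Fintype.card M : ℝ) - 1)) ≤ 1 := by
    rw [div_le_one (by linarith)]
    linarith
  obtain ⟨σ, hσ⟩ := exists_isBackwardGreedy (J := J) s
  refine le_trans ?_ (mul_le_mul_of_nonneg_left (hσ.socialCost_le hs hp hSPT ρ) (by linarith))
  set n : J → ℝ := fun k => laterCount σ k (σ k) with hn
  set g : J → ℝ := fun k =>
    p k * ((2 * n k + 1) / s (σ k)) - p k * ((laterCount σ k (τ k) : ℝ) / s (τ k)) with hg
  have hn0 : ∀ k, 0 ≤ n k := fun k => Nat.cast_nonneg _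
  have hopt : socialCost s p σ = ∑ k, p k * ((n k + 1) / s (σ k)) :=
    socialCost_eq_sum_laterCount s p σ
  have hcost : socialCost s p τ ≤ 2 * socialCost s p σ - ∑ k, g k := by
    calc socialCost s p τ
        ≤ ∑ j, (∑ k with k < j ∧ τ k = σ j, p k + p j) / s (σ j) :=
          Finset.sum_le_sum fun j _ => hτ j (σ j)
      _ = ∑ k, (p k * ((laterCount σ k (τ k) : ℝ) / s (τ k)) + p k / s (σ k)) := by
          simp_rw [add_div]
          rw [Finset.sum_add_distrib, sum_sum_lt_div_eq, Finset.sum_add_distrib]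
      _ = 2 * socialCost s p σ - ∑ k, g k := by
          rw [hopt, Finset.mul_sum, ← Finset.sum_sub_distrib]
          refine Finset.sum_congr rfl fun k _ => ?_
          simp only [hg]
          ring
  have hgn : ∀ k, p k * (n k / s (σ k)) ≤ g k := by
    intro k
    have h := mul_le_mul_of_nonneg_left (hσ.laterCount_div_le hs k (τ k)) (hp k)
    have h' : p k * ((2 * n k + 1) / s (σ k)) =
      p k * (n k / s (σ k)) + p k * ((n k + 1) / s (σ k)) := by ring
    simp only [hg]
    rw [h']
    linarith
  have hg0 : ∀ k, 0 ≤ g k := fun k =>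
    (mul_nonneg (hp k) (div_nonneg (hn0 k) (hs _).le)).trans (hgn k)
  have hG0 : 0 ≤ ∑ k, g k := Finset.sum_nonneg fun k _ => hg0 k
  -- This is at least as strong as needed, since `2 m ≤ 2 (2 m - 1)` for `m ≥ 1`.
  suffices h : socialCost s p σ ≤ 2 * Fintype.card M * ∑ k, g k by
    have h1 : socialCost s p σ ≤ (2 * (2 * (Fintype.card M : ℝ) - 1)) * ∑ k, g k :=
      h.trans (mul_le_mul_of_nonneg_right (by linarith) hG0)
    rw [← div_le_iff₀' (by linarith)] at h1
    have h2 : (2 - 1 / (2 * (2 * (Fintype.card M : ℝ) - 1))) * socialCost s p σ =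
      2 * socialCost s p σ - socialCost s p σ / (2 * (2 * (Fintype.card M : ℝ) - 1)) := by ring
    rw [h2]
    linarith
  cases isEmpty_or_nonempty J
  · simp [socialCost]
  obtain ⟨N, hN⟩ : ∃ N : J, ∀ k, k ≤ N := Finite.exists_max id
  have hNlast : ∀ i, laterCount σ N i = 0 := by
    intro i
    rw [laterCount, Finset.card_eq_zero, Finset.filter_eq_empty_iff]
    exact fun x _ hx => (hN x).not_gt hx.1
  have hgN : ∀ j, σ j = σ N → p j / s (σ N) ≤ g j := by
    intro j hj
    rcases (hN j).eq_or_lt with rfl | hlt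
    · simp [hg, hn, hNlast, div_eq_mul_inv]
    · refine le_trans ?_ (hgn j)
      rw [hj, div_eq_mul_one_div]
      refine mul_le_mul_of_nonneg_left (div_le_div_of_nonneg_right ?_ (hs _).le) (hp j)
      exact Nat.one_le_cast.2 (Finset.card_pos.2 ⟨N, by simp [hlt, hj]⟩)
  -- Let `q ≥ 1` count the jobs after `k` on the machine of `N`. Greediness bounds the term by `(q +
  -- 1) * p k / s (σ N)`, at most twice `q * p k / s (σ N)`; by SPT each of these `q` jobs has slack
  -- at least `p k / s (σ N)`.
  have hlast : ∀ k, k ≠ N → p k * ((n k + 1) / s (σ k)) ≤ 2 * ∑ k, g k := by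
    intro k hk
    have hkN : k < N := lt_of_le_of_ne (hN k) hk
    have hq : (1 : ℝ) ≤ laterCount σ k (σ N) := by
      have : 0 < laterCount σ k (σ N) := Finset.card_pos.2 ⟨N, by simp [hkN]⟩
      exact_mod_cast this
    have h1 : (laterCount σ k (σ N) : ℝ) * (p k / s (σ N)) ≤ ∑ k, g k := by
      rw [laterCount, ← nsmul_eq_mul]
      refine (Finset.card_nsmul_le_sum _ g _ fun j hj => ?_).trans
        (Finset.sum_le_univ_sum_of_nonneg hg0)
      simp only [Finset.mem_filter, Finset.mem_univ, true_and] at hj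
      exact (div_le_div_of_nonneg_right (hSPT hj.1.le) (hs _).le).trans (hgN j hj.2)
    have h2 := mul_le_mul_of_nonneg_left (hσ k (σ N)) (hp k)
    have h3 : p k * (((laterCount σ k (σ N) : ℝ) + 1) / s (σ N)) =
      (laterCount σ k (σ N) : ℝ) * (p k / s (σ N)) + 1 * (p k / s (σ N)) := by ring
    have h4 := mul_le_mul_of_nonneg_right hq (div_nonneg (hp k) (hs (σ N)).le)
    linarith
  -- The last jobs of the machines. `N` is set apart, as its own slack covers it; so only `m - 1`
  -- terms need `hlast`.
  set E : Finset J := {k : J | laterCount σ k (σ k) = 0} with hE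
  have hNE : N ∈ E := by simp [hE, hNlast]
  have hcardE : #E ≤ Fintype.card M := by
    refine Finset.card_le_card_of_injOn σ (fun _ _ => Finset.mem_univ _) ?_
    have key : ∀ x ∈ E, ∀ y, σ x = σ y → y ≤ x := by
      intro x hx y hxy
      by_contra! hlt
      simp only [hE, Finset.mem_filter, Finset.mem_univ, true_and, laterCount,
        Finset.card_eq_zero, Finset.filter_eq_empty_iff, not_and] at hx
      exact hx trivial hlt hxy.symm
    intro x hx y hy hxy
    exact le_antisymm (key y hy x hxy.symm) (key x hx y hxy)
  have hsplit : ∑ k ∈ E.erase N, p k * ((n k + 1) / s (σ k)) +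
      ∑ k ∈ (E.erase N)ᶜ, p k * ((n k + 1) / s (σ k)) = socialCost s p σ := by
    rw [hopt, Finset.sum_add_sum_compl]
  have h1 : ∑ k ∈ E.erase N, p k * ((n k + 1) / s (σ k)) ≤
      ((Fintype.card M : ℝ) - 1) * (2 * ∑ k, g k) := by
    refine (Finset.sum_le_card_nsmul _ _ _ fun k hk => hlast k (Finset.ne_of_mem_erase hk)).trans ?_
    rw [nsmul_eq_mul, Finset.card_erase_of_mem hNE, Nat.cast_pred (Finset.card_pos.2 ⟨N, hNE⟩)]
    refine mul_le_mul_of_nonneg_right ?_ (by linarith)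
    have : (#E : ℝ) ≤ Fintype.card M := by exact_mod_cast hcardE
    linarith
  have h2 : ∑ k ∈ (E.erase N)ᶜ, p k * ((n k + 1) / s (σ k)) ≤ 2 * ∑ k, g k := by
    rw [Finset.mul_sum]
    refine (Finset.sum_le_sum fun k hk => ?_).trans
      (Finset.sum_le_univ_sum_of_nonneg fun k => mul_nonneg zero_le_two (hg0 k))
    by_cases hkN : k = N
    · have := hgN k (by rw [hkN])
      have h0 : n k = 0 := by simp [hn, hkN, hNlast]
      rw [h0, hkN, zero_add, mul_one_div]
      rw [hkN] at this
      linarith [hg0 N]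
    · have hk0 : laterCount σ k (σ k) ≠ 0 := by
        intro h0
        exact Finset.mem_compl.1 hk (Finset.mem_erase.2 ⟨hkN, by simp [hE, h0]⟩)
      have hk1 : 1 ≤ n k := Nat.one_le_cast.2 (Nat.pos_of_ne_zero hk0)
      have h3 : p k * ((n k + 1) / s (σ k)) ≤ p k * (2 * n k / s (σ k)) :=
        mul_le_mul_of_nonneg_left (div_le_div_of_nonneg_right (by linarith) (hs _).le) (hp k)
      have h4 : p k * (2 * n k / s (σ k)) = 2 * (p k * (n k / s (σ k))) := by ring
      linarith [hgn k]
  linarith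

/-! ### Nash equilibria and the price of anarchy. -/

theorem IsNashEquilibrium.completionTime_le {s : M → ℝ} {p : J → ℝ} {τ : J → M}
    (hτ : IsNashEquilibrium s p τ) (j : J) (i : M) :
    completionTime s p τ j ≤ (∑ k with k < j ∧ τ k = i, p k + p j) / s i := by
  refine (hτ j i).trans_eq ?_
  have h : ({k : J | k ≤ j ∧ Function.update τ j i k = Function.update τ j i j} : Finset J) =
      insert j ({k : J | k < j ∧ τ k = i} : Finset J) := by
    ext k
    simp only [Finset.mem_filter, Finset.mem_univ, true_and, Finset.mem_insert,
      Function.update_self]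
    rcases eq_or_ne k j with rfl | hk
    · simp
    · simp [hk, le_iff_lt_or_eq]
  rw [completionTime, h, Function.update_self, ← Finset.sum_div, Finset.sum_insert (by simp),
    add_comm]

theorem priceOfAnarchy_le [Fintype M] [Nonempty M] {s : M → ℝ} (hs : ∀ i, 0 < s i)
    {p : J → ℝ} (hp : ∀ j, 0 ≤ p j) (hSPT : Monotone p) :
    priceOfAnarchy s p ≤ ENNReal.ofReal (2 - 1 / (2 * (2 * (Fintype.card M : ℝ) - 1))) := by
  have hm : (1 : ℝ) ≤ Fintype.card M := by exact_mod_cast Fintype.card_pos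
  have hδ : 1 / (2 * (2 * (Fintype.card M : ℝ) - 1)) ≤ 1 := by
    rw [div_le_one (by linarith)]
    linarith
  refine iSup₂_le fun τ hτ => ?_
  obtain ⟨ρ, hρ⟩ := exists_eq_ciInf_of_finite (f := fun τ : J → M => socialCost s p τ)
  -- The product form also covers optimum zero, where it forces the equilibrium cost to vanish.
  refine ENNReal.div_le_of_le_mul ?_
  rw [← ENNReal.ofReal_mul (by linarith), optimalCost, ← hρ]
  exact ENNReal.ofReal_le_ofReal
    (socialCost_le_mul_socialCost hs hp hSPT hτ.completionTime_le ρ)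

end Game

/-! ### List schedules versus profiles. -/

theorem sum_take_cons (p : J → ℝ) (x : J) (l : List J) :
    ∑ r ∈ Finset.range (x :: l).length, (((x :: l).take (r + 1)).map p).sum =
      ((l.length : ℝ) + 1) * p x + ∑ r ∈ Finset.range l.length, ((l.take (r + 1)).map p).sum := by
  simp only [List.length_cons, List.take_succ_cons, List.map_cons, List.sum_cons]
  rw [Finset.sum_add_distrib, Finset.sum_const, Finset.card_range,
    Finset.sum_range_succ' (fun r => ((l.take r).map p).sum), nsmul_eq_mul]
  simp

section Lists

variable [LinearOrder J]

/-- Each pair of jobs on a machine costs the processing time of its earlier member. -/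
theorem sum_sum_le_insert (p : J → ℝ) {x : J} {t : Finset J} (hx : x ∉ t) :
    ∑ j ∈ insert x t, ∑ k ∈ insert x t with k ≤ j, p k =
      p x + ∑ j ∈ t, (if j ≤ x then p j else p x) + ∑ j ∈ t, ∑ k ∈ t with k ≤ j, p k := by
  have h : ∀ j ∈ t, ∑ k ∈ insert x t with k ≤ j, p k =
      (if x ≤ j then p x else 0) + ∑ k ∈ t with k ≤ j, p k := by
    intro j _
    rw [Finset.filter_insert]
    split_ifs
    · rw [Finset.sum_insert (by simp [hx])]
    · rw [zero_add]
  rw [Finset.sum_insert hx, Finset.sum_congr rfl h, Finset.sum_add_distrib, Finset.filter_insert,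
    if_pos le_rfl, Finset.sum_insert (by simp [hx]), Finset.sum_filter]
  have h' : ∑ j ∈ t, (if j ≤ x then p j else p x) =
      ∑ j ∈ t, (if j ≤ x then p j else 0) + ∑ j ∈ t, (if x ≤ j then p x else 0) := by
    rw [← Finset.sum_add_distrib]
    refine Finset.sum_congr rfl fun j hj => ?_
    rcases lt_or_gt_of_ne (ne_of_mem_of_not_mem hj hx) with hlt | hlt
    · simp [hlt.le, hlt.not_ge]
    · simp [hlt.le, hlt.not_ge]
  rw [h']
  ring

/-- Optimality of SPT on one machine: in priority order a pair costs its smaller processing time, in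
the list that of whichever job comes first. -/
theorem sum_sum_le_le_sum_take {p : J → ℝ} (hSPT : Monotone p) {l : List J} (hl : l.Nodup) :
    ∑ j ∈ l.toFinset, ∑ k ∈ l.toFinset with k ≤ j, p k ≤
      ∑ r ∈ Finset.range l.length, ((l.take (r + 1)).map p).sum := by
  induction l with
  | nil => simp
  | cons x l ih =>
    rw [List.nodup_cons] at hl
    rw [sum_take_cons, List.toFinset_cons, sum_sum_le_insert p (by simpa using hl.1)]
    have h : ∑ j ∈ l.toFinset, (if j ≤ x then p j else p x) ≤ l.length * p x := by
      rw [← List.toFinset_card_of_nodup hl.2, ← nsmul_eq_mul]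
      refine Finset.sum_le_card_nsmul _ _ _ fun j _ => ?_
      split_ifs with hj
      exacts [hSPT hj, le_rfl]
    linarith [ih hl.2]

theorem sum_take_eq_sum_sum_le (p : J → ℝ) {l : List J} (hl : l.Pairwise (· < ·)) :
    ∑ r ∈ Finset.range l.length, ((l.take (r + 1)).map p).sum =
      ∑ j ∈ l.toFinset, ∑ k ∈ l.toFinset with k ≤ j, p k := by
  induction l with
  | nil => simp
  | cons x l ih =>
    rw [List.pairwise_cons] at hl
    have hx : x ∉ l := fun h => (hl.1 x h).false
    rw [sum_take_cons, List.toFinset_cons, sum_sum_le_insert p (by simpa using hx), ih hl.2]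
    have h : ∑ j ∈ l.toFinset, (if j ≤ x then p j else p x) = l.length * p x := by
      rw [← List.toFinset_card_of_nodup (hl.2.imp ne_of_lt), ← nsmul_eq_mul, ← Finset.sum_const]
      exact Finset.sum_congr rfl fun j hj => if_neg (hl.1 j (List.mem_toFinset.1 hj)).not_ge
    linarith

variable [Fintype J] [DecidableEq M]

theorem socialCost_eq_sum_machines [Fintype M] (s : M → ℝ) (p : J → ℝ) {S : M → List J}
    {ρ : J → M} (hρ : ∀ i j, j ∈ S i ↔ ρ j = i) :
    socialCost s p ρ =
      ∑ i, (∑ j ∈ (S i).toFinset, ∑ k ∈ (S i).toFinset with k ≤ j, p k) / s i := by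
  have hS : ∀ i, (S i).toFinset = ({j : J | ρ j = i} : Finset J) := by
    intro i
    ext j
    simp [hρ]
  rw [socialCost, ← Finset.sum_fiberwise (s := Finset.univ) (g := ρ)]
  refine Finset.sum_congr rfl fun i _ => ?_
  rw [hS, Finset.sum_div]
  refine Finset.sum_congr rfl fun j hj => ?_
  have hj' : ρ j = i := by simpa using hj
  rw [completionTime, hj', Finset.filter_filter, Finset.sum_div]
  simp_rw [and_comm]

theorem IsSchedule.exists_socialCost_le [Fintype M] {s : M → ℝ} (hs : ∀ i, 0 < s i) {p : J → ℝ}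
    (hSPT : Monotone p) {S : M → List J} (hS : IsSchedule S) :
    ∃ ρ : J → M, socialCost s p ρ ≤ totalCompletionTime s p S := by
  choose ρ hρ hρ' using hS.2
  refine ⟨ρ, ?_⟩
  rw [socialCost_eq_sum_machines s p (S := S)
      fun i j => ⟨fun h => (hρ' j i h).symm, fun h => h ▸ hρ j⟩,
    totalCompletionTime]
  refine Finset.sum_le_sum fun i _ => ?_
  rw [← Finset.sum_div]
  exact div_le_div_of_nonneg_right (sum_sum_le_le_sum_take hSPT (hS.1 i)) (hs i).le

end Lists

/-! ### Greedy runs and the Ibarra–Kim bound. -/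

theorem GreedyRun.exists_profile [DecidableEq J] [DecidableEq M] [Nonempty M] {s : M → ℝ}
    {p : J → ℝ} {l : List J} {S T : M → List J} (h : GreedyRun s p l S T) (hl : l.Nodup) :
    ∃ τ : J → M, (∀ i, T i = S i ++ l.filter (τ · = i)) ∧
      ∀ l₁ k l₂, l = l₁ ++ k :: l₂ → ∀ i,
        finishTime s p (fun i => S i ++ l₁.filter (τ · = i)) k (τ k) ≤
          finishTime s p (fun i => S i ++ l₁.filter (τ · = i)) k i := by
  induction h with
  | nil S => exact ⟨fun _ => Classical.arbitrary M, by simp⟩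
  | cons k l S T i₀ hi _ ih =>
    rw [List.nodup_cons] at hl
    obtain ⟨τ, hT, hτ⟩ := ih hl.2
    have hne : ∀ j ∈ l, Function.update τ k i₀ j = τ j := fun j hj =>
      Function.update_of_ne (ne_of_mem_of_not_mem hj hl.1) _ _
    have hfil : ∀ l' : List J, (∀ j ∈ l', j ∈ l) → ∀ i,
        S i ++ (k :: l').filter (Function.update τ k i₀ · = i) =
          Function.update S i₀ (S i₀ ++ [k]) i ++ l'.filter (τ · = i) := by
      intro l' hl' i
      have : l'.filter (Function.update τ k i₀ · = i) = l'.filter (τ · = i) :=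
        List.filter_congr fun j hj => by rw [hne j (hl' j hj)]
      rw [List.filter_cons, this, Function.update_self]
      rcases eq_or_ne i i₀ with rfl | hii
      · simp
      · simp [Function.update_of_ne hii, Ne.symm hii]
    refine ⟨Function.update τ k i₀, fun i => ?_, fun l₁ k' l₂ hk' i => ?_⟩
    · rw [hT, hfil l fun _ hj => hj]
    · cases l₁ with
      | nil =>
        rw [List.nil_append, List.cons.injEq] at hk'
        simpa [← hk'.1] using hi i
      | cons x l₁ =>
        rw [List.cons_append, List.cons.injEq] at hk'
        obtain ⟨rfl, rfl⟩ := hk'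
        have hfun := funext (hfil l₁ fun j hj => List.mem_append_left _ hj)
        rw [hfun, hne k' (by simp)]
        exact hτ l₁ k' l₂ rfl i

theorem GreedyRun.totalCompletionTime_le [Fintype J] [LinearOrder J] [Fintype M] [DecidableEq M]
    [Nonempty M] {s : M → ℝ} (hs : ∀ i, 0 < s i) {p : J → ℝ} (hp : ∀ j, 0 ≤ p j)
    (hSPT : Monotone p) {l : List J} (hl : l.Pairwise (· < ·)) (hmem : ∀ j, j ∈ l)
    {T : M → List J} (hT : GreedyRun s p l (fun _ => []) T) {S : M → List J} (hS : IsSchedule S) :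
    totalCompletionTime s p T ≤
      (2 - 1 / (2 * (2 * (Fintype.card M : ℝ) - 1))) * totalCompletionTime s p S := by
  have hm : (1 : ℝ) ≤ Fintype.card M := by exact_mod_cast Fintype.card_pos
  have hδ : 1 / (2 * (2 * (Fintype.card M : ℝ) - 1)) ≤ 1 := by
    rw [div_le_one (by linarith)]
    linarith
  obtain ⟨ρ, hρ⟩ := hS.exists_socialCost_le hs hSPT
  refine le_trans ?_ (mul_le_mul_of_nonneg_left hρ (by linarith))
  obtain ⟨τ, hTτ, hτ⟩ := hT.exists_profile (hl.imp ne_of_lt)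
  simp only [List.nil_append] at hTτ hτ
  have hcost : totalCompletionTime s p T = socialCost s p τ := by
    rw [socialCost_eq_sum_machines s p (S := T) fun i j => by simp [hTτ, hmem],
      totalCompletionTime]
    refine Finset.sum_congr rfl fun i _ => ?_
    rw [← Finset.sum_div, sum_take_eq_sum_sum_le p (hTτ i ▸ hl.filter _)]
  rw [hcost]
  refine socialCost_le_mul_socialCost hs hp hSPT (fun j i => ?_) ρ
  obtain ⟨l₁, l₂, hsplit⟩ := List.append_of_mem (hmem j)
  rw [hsplit, List.pairwise_append, List.pairwise_cons] at hl
  -- Jobs placed before `j` are exactly those of higher priority, so the greedy choice is the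
  -- insertion inequality required of `τ`.
  have hl₁ : ∀ k, k ∈ l₁ ↔ k < j := by
    intro k
    refine ⟨fun hk => hl.2.2 k hk j (List.mem_cons_self ..), fun hk => ?_⟩
    have := hmem k
    rw [hsplit, List.mem_append, List.mem_cons] at this
    rcases this with h | rfl | h
    · exact h
    · exact absurd hk (lt_irrefl _)
    · exact absurd hk (hl.2.1.1 k h).not_gt
  have hload : ∀ i, ((l₁.filter (τ · = i)).map p).sum = ∑ k with k < j ∧ τ k = i, p k := by
    intro i
    rw [← List.sum_toFinset _ ((hl.1.imp ne_of_lt).filter _)]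
    refine Finset.sum_congr ?_ fun _ _ => rfl
    ext k
    simp [hl₁]
  have h := hτ l₁ j l₂ hsplit i
  simp only [finishTime, hload] at h
  refine le_trans (le_of_eq ?_) h
  have hins : ({k : J | k ≤ j ∧ τ k = τ j} : Finset J) =
      insert j ({k : J | k < j ∧ τ k = τ j} : Finset J) := by
    ext k
    simp only [Finset.mem_filter, Finset.mem_univ, true_and, Finset.mem_insert]
    rcases eq_or_ne k j with rfl | hk
    · simp
    · simp [hk, le_iff_lt_or_eq]
  rw [completionTime, hins, ← Finset.sum_div, Finset.sum_insert (by simp), add_comm]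

theorem IsIbarraKimOutput.totalCompletionTime_le [Fintype J] [Fintype M] [DecidableEq M]
    [Nonempty M] {s : M → ℝ} (hs : ∀ i, 0 < s i) {p : J → ℝ} (hp : ∀ j, 0 ≤ p j)
    {T : M → List J} (hT : IsIbarraKimOutput s p T) {S : M → List J} (hS : IsSchedule S) :
    totalCompletionTime s p T ≤
      (2 - 1 / (2 * (2 * (Fintype.card M : ℝ) - 1))) * totalCompletionTime s p S := by
  classical
  obtain ⟨l, hnd, hmem, hsorted, hrun⟩ := hT
  let e : Fin l.length ≃ J := hnd.getEquivOfForallMemList l hmem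
  have he : ∀ a, e a = l.get a := fun _ => rfl
  -- The run's own list supplies the priority order, so ties in `p` are resolved as the run did.
  let _ : LinearOrder J := LinearOrder.lift' e.symm e.symm.injective
  have hle : ∀ j k : J, j ≤ k ↔ e.symm j ≤ e.symm k := fun _ _ => Iff.rfl
  have hlt : ∀ j k : J, j < k ↔ e.symm j < e.symm k := fun _ _ => Iff.rfl
  rw [List.pairwise_iff_get] at hsorted
  refine GreedyRun.totalCompletionTime_le hs hp (fun j k hjk => ?_) ?_ hmem hrun hS
  · rw [hle] at hjk
    rcases hjk.eq_or_lt with h | h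
    · rw [e.symm.injective h]
    · have := hsorted _ _ h
      rwa [← he, ← he, e.apply_symm_apply, e.apply_symm_apply] at this
  · rw [List.pairwise_iff_get]
    intro a b hab
    rw [hlt, ← he, ← he, e.symm_apply_apply, e.symm_apply_apply]
    exact hab

end RelatedMachines

theorem theorem4 {J M : Type*} [Fintype J] [LinearOrder J] [Fintype M] [DecidableEq M] [Nonempty M]
    (s : M → ℝ) (hs : ∀ i, 0 < s i)
    (p : J → ℝ) (hp : ∀ j, 0 ≤ p j) (hSPT : Monotone p) :
    RelatedMachines.priceOfAnarchy s p ≤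
        ENNReal.ofReal (2 - 1 / (2 * (2 * (Fintype.card M : ℝ) - 1))) ∧
      ∀ T : M → List J, RelatedMachines.IsIbarraKimOutput s p T →
        ∀ S : M → List J, RelatedMachines.IsSchedule S →
          RelatedMachines.totalCompletionTime s p T ≤
            (2 - 1 / (2 * (2 * (Fintype.card M : ℝ) - 1))) *
              RelatedMachines.totalCompletionTime s p S :=
  ⟨RelatedMachines.priceOfAnarchy_le hs hp hSPT,
    fun _ hT _ hS => hT.totalCompletionTime_le hs hp hS⟩
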